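/- Let $\mathbb G$ be a finite quantum group, i.e. let $C(\mathbb G)=\mathcal O(\mathbb G)$ be a finite-dimensional CQG Hopf $*$-algebra (a Hopf $*$-algebra over $\mathbb C$ spanned by the coefficients of its finite-dimensional unitary corepresentations), with coproduct $\Delta$, counit $\varepsilon$ and antipode $S$. Let $\psi$ be its Haar functional normalised to be a 1-form: $\psi$ is bi-invariant, positive, faithful and tracial, and $m m^*=\mathrm{id}$, where $m$ is the multiplication of $C(\mathbb G)$ and $m^*$ its adjoint for the inner product $\langle x,y\rangle=\psi(x^*y)$. For $x\in C(\mathbb G)$ put $\psi_x=\psi(x\,\cdot)$ and let $x\,\star=(\psi_{S(x)}\otimes\mathrm{id})\circ\Delta$ be the operator of convolution by $x$. Let $C(\widehat{\mathbb G})$ be the dual space $C(\mathbb G)^*$ with the product $\omega*\omega'=(\omega\otimes\omega')\circ\Delta$ and the unit $\varepsilon$; the Fourier transform of $x$ is $\mathcal F(x)=\psi_x\in C(\widehat{\mathbb G})$. A quantum graph on $(C(\mathbb G),\psi)$ is a linear map $A:C(\mathbb G)\to C(\mathbb G)$ with $m(A\otimes A)m^*=A$ and $A(f^*)^*=A(f)$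 for all $f$. An action of a compact quantum group $\mathbb H$ (given by a CQG Hopf $*$-algebra $\mathcal O(\mathbb H)$) on $(\mathbb G,A)$ is an injective unital $*$-homomorphism $\beta:C(\mathbb G)\to C(\mathbb G)\otimes\mathcal O(\mathbb H)$ such that $(\beta\otimes\mathrm{id})\beta=(\mathrm{id}\otimes\Delta_{\mathbb H})\beta$, $(\psi\otimes\mathrm{id})\beta=\psi(\cdot)1$ and $(A\otimes\mathrm{id})\beta=\beta A$. It is faithful if the elements $(\omega\otimes\mathrm{id})\beta(b)$, with $b\in C(\mathbb G)$ and $\omega\in C(\mathbb G)^*$, generate $\mathcal O(\mathbb H)$ as a Hopf $*$-algebra. The quantum automorphism group $\mathrm{Qut}(\mathbb G,A)$ is the universal compact quantum group acting (faithfully, by $\alpha$ say) on $(\mathbb G,A)$: for every action $\beta$ of a compact quantum group $\mathbb H$ on $(\mathbb G,A)$ there is a unique Hopf $*$-algebra morphism $\gamma:\mathcal O(\mathrm{Qut}(\mathbb G,A))\to\mathcal O(\mathbb H)$ with $\beta=(\mathrm{id}\otimes\gamma)\alpha$. **Proposition.** Let $P\in C(\mathbb G)$ be an orthogonal projection ($P=P^*=P^2$)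 whose convolution powers generate $C(\mathbb G)$, in the sense that $\mathcal F(P)$ generates $C(\widehat{\mathbb G})$ as a unital algebra, and let $A=P\,\star$. Then $A$ is a quantum graph and $\mathbb G=\mathrm{Qut}(\mathbb G,A)$: the pair $(C(\mathbb G),\Delta)$ is the universal compact quantum group acting on $(\mathbb G,A)$. Consequently, for every compact quantum group $\mathbb Q$ with an action $\alpha$ that has this universal property, there is an isomorphism of Hopf $*$-algebras $q:\mathcal O(\mathbb Q)\to C(\mathbb G)$ with $(\mathrm{id}\otimes q)\alpha=\Delta$. -/

import Mathlib

open scoped TensorProduct ComplexOrder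

universe u v w

noncomputable section

namespace QuantumCayley

/-- An `n × n` matrix `u` over a Hopf `*`-algebra is a finite-dimensional unitary
(co)representation: `Δ(u i j) = ∑ k, u i k ⊗ u k j`, and `u` is unitary. -/
structure IsUnitaryCorep {H : Type u} [Ring H] [StarRing H] [HopfAlgebra ℂ H]
    {n : ℕ} (u : Matrix (Fin n) (Fin n) H) : Prop where
  comul_apply : ∀ i j, Coalgebra.comul (R := ℂ) (u i j) = ∑ k, u i k ⊗ₜ[ℂ] u k j
  mul_conjTranspose : u * u.conjTranspose = 1
  conjTranspose_mul : u.conjTranspose * u = 1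

/-- `H` is a CQG Hopf `*`-algebra, i.e. `H = 𝒪(ℍ)` for a compact quantum group `ℍ`: the
coproduct and the counit are `*`-preserving, and `H` is the linear span of the coefficients
of its finite-dimensional unitary corepresentations. If moreover `H` is finite dimensional,
then `ℍ` is a finite quantum group and `H = C(ℍ)`. -/
class IsCQG (H : Type u) [Ring H] [StarRing H] [HopfAlgebra ℂ H] [StarModule ℂ H] : Prop where
  comul_star : ∀ x : H,
    Coalgebra.comul (R := ℂ) (star x) = star (Coalgebra.comul (R := ℂ) x)
  counit_star : ∀ x : H,
    Coalgebra.counit (R := ℂ) (star x) = star (Coalgebra.counit (R := ℂ) x)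
  span_coeff : Submodule.span ℂ {x : H | ∃ (n : ℕ) (u : Matrix (Fin n) (Fin n) H),
    IsUnitaryCorep u ∧ ∃ i j, x = u i j} = ⊤

section QuantumSets

variable {B : Type u} [Ring B] [StarRing B] [Algebra ℂ B] [StarModule ℂ B]

/-- `d : B → B ⊗ B` is the adjoint `m^*` of the multiplication `m : B ⊗ B → B` with respect
to the inner products `⟨x, y⟩ = ψ(x^* y)` on `B` and
`⟨s, t⟩ = (ψ ⊗ ψ)(s^* t)` on `B ⊗ B`, that is `⟨d x, t⟩ = ⟨x, m t⟩`. -/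
def IsMulAdjoint (ψ : B →ₗ[ℂ] ℂ) (d : B →ₗ[ℂ] B ⊗[ℂ] B) : Prop :=
  ∀ (x : B) (t : B ⊗[ℂ] B),
    LinearMap.mul' ℂ ℂ (TensorProduct.map ψ ψ (star (d x) * t)) =
      ψ (star x * LinearMap.mul' ℂ B t)

/-- The finite-dimensional `*`-algebra `B = C(𝕏)` with the functional `ψ` is a finite quantum
set: `ψ` is a faithful positive trace (such a `ψ` makes `B` a `C^*`-algebra) which is a
1-form, `m m^* = id`. -/
structure IsFiniteQuantumSet (ψ : B →ₗ[ℂ] ℂ) : Prop where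
  finiteDimensional : FiniteDimensional ℂ B
  nonneg : ∀ x : B, 0 ≤ ψ (star x * x)
  faithful : ∀ x : B, ψ (star x * x) = 0 → x = 0
  tracial : ∀ x y : B, ψ (x * y) = ψ (y * x)
  one_form : ∃ d, IsMulAdjoint ψ d ∧ LinearMap.mul' ℂ B ∘ₗ d = LinearMap.id

/-- `A` is a quantum adjacency matrix on `(B, ψ)`: a Schur idempotent,
`A • A = m (A ⊗ A) m^* = A`, which is real, `(A f^*)^* = A f`. -/
structure IsQuantumGraph (ψ : B →ₗ[ℂ] ℂ) (A : B →ₗ[ℂ] B) : Prop where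
  schur_idempotent : ∃ d, IsMulAdjoint ψ d ∧
    LinearMap.mul' ℂ B ∘ₗ TensorProduct.map A A ∘ₗ d = A
  real : ∀ f : B, star (A (star f)) = A f

variable {H : Type v} [Ring H] [StarRing H] [HopfAlgebra ℂ H] [StarModule ℂ H]

/-- `α : B → B ⊗ 𝒪(ℍ)` (a unital `*`-homomorphism) is an action of `ℍ` on `B`: it is injective
and `(α ⊗ id) α = (id ⊗ Δ) α`. -/
structure IsAction (α : B →⋆ₐ[ℂ] B ⊗[ℂ] H) : Prop where
  injective : Function.Injective α
  action_eq : ∀ b : B,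
    TensorProduct.assoc ℂ B H H
        (TensorProduct.map α.toAlgHom.toLinearMap LinearMap.id (α b)) =
      TensorProduct.map LinearMap.id (Coalgebra.comul (R := ℂ) (A := H)) (α b)

/-- `α` is an action on the quantum graph `(B, ψ, A)`: an action which preserves `ψ`,
`(ψ ⊗ id) α = ψ(·) 1`, and `A`, `(A ⊗ id) α = α A`. -/
structure IsGraphAction (ψ : B →ₗ[ℂ] ℂ) (A : B →ₗ[ℂ] B) (α : B →⋆ₐ[ℂ] B ⊗[ℂ] H) : Prop
    extends IsAction α where
  preserves_functional : ∀ b : B,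
    TensorProduct.lid ℂ H (TensorProduct.map ψ LinearMap.id (α b)) = ψ b • (1 : H)
  preserves_adjacency : ∀ b : B, TensorProduct.map A LinearMap.id (α b) = α (A b)

/-- `α` is faithful: the Hopf `*`-subalgebra of `H` generated by the slices
`(ω ⊗ id)(α b)` is all of `H`. -/
def IsFaithfulAction (α : B →⋆ₐ[ℂ] B ⊗[ℂ] H) : Prop :=
  ∀ D : StarSubalgebra ℂ H,
    (∀ (ω : B →ₗ[ℂ] ℂ) (b : B),
      TensorProduct.lid ℂ H (TensorProduct.map ω LinearMap.id (α b)) ∈ D) →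
    (∀ x ∈ D, HopfAlgebra.antipode ℂ x ∈ D) →
    (∀ x ∈ D, Coalgebra.comul (R := ℂ) x ∈
      LinearMap.range (TensorProduct.map (Subalgebra.toSubmodule D.toSubalgebra).subtype
        (Subalgebra.toSubmodule D.toSubalgebra).subtype)) →
    D = ⊤

end QuantumSets

/-- `(Q, α)` is the quantum automorphism group `Qut(𝕏, A)` of the quantum graph `(B, ψ, A)`,
`B = C(𝕏)`: the universal compact quantum group acting (faithfully) on it. Universality: for
every action `β` of a compact quantum group `ℍ` on the quantum graph there is a unique Hopf
`*`-algebra morphism `γ : Q → 𝒪(ℍ)` with `β = (id ⊗ γ) α`. -/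
structure IsQut {B : Type u} [Ring B] [StarRing B] [Algebra ℂ B] [StarModule ℂ B]
    (ψ : B →ₗ[ℂ] ℂ) (A : B →ₗ[ℂ] B)
    (Q : Type v) [Ring Q] [StarRing Q] [HopfAlgebra ℂ Q] [StarModule ℂ Q]
    (α : B →⋆ₐ[ℂ] B ⊗[ℂ] Q) : Prop where
  isCQG : IsCQG Q
  isGraphAction : IsGraphAction ψ A α
  isFaithful : IsFaithfulAction α
  universal : ∀ (H : Type w) [Ring H] [StarRing H] [HopfAlgebra ℂ H] [StarModule ℂ H]
    [IsCQG H] (β : B →⋆ₐ[ℂ] B ⊗[ℂ] H), IsGraphAction ψ A β →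
      ∃! γ : Q →ₐc[ℂ] H, (∀ x, γ (star x) = star (γ x)) ∧
        ∀ b : B, TensorProduct.map LinearMap.id (γ : Q →ₗ[ℂ] H) (α b) = β b

section FiniteQuantumGroups

variable {C : Type u} [Ring C] [StarRing C] [HopfAlgebra ℂ C] [StarModule ℂ C]

/-- `ψ` is bi-invariant: `(ψ ⊗ id) Δ = ψ(·) 1 = (id ⊗ ψ) Δ`. -/
structure IsBiInvariant (ψ : C →ₗ[ℂ] ℂ) : Prop where
  left : ∀ x : C, TensorProduct.lid ℂ C
    (TensorProduct.map ψ LinearMap.id (Coalgebra.comul (R := ℂ) x)) = ψ x • (1 : C)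
  right : ∀ x : C, TensorProduct.rid ℂ C
    (TensorProduct.map LinearMap.id ψ (Coalgebra.comul (R := ℂ) x)) = ψ x • (1 : C)

/-- `ψ` is the Haar functional of the finite quantum group, normalised to be a 1-form: it is
bi-invariant, and `(C, ψ)` is a finite quantum set. -/
structure IsHaarOneForm (ψ : C →ₗ[ℂ] ℂ) : Prop extends IsFiniteQuantumSet ψ, IsBiInvariant ψ

/-- The functional `ψ_x = ψ(x ·)`. -/
def density (ψ : C →ₗ[ℂ] ℂ) (x : C) : C →ₗ[ℂ] ℂ := ψ ∘ₗ LinearMap.mulLeft ℂ x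

/-- `L_ω = (ω ⊗ id) Δ`. -/
def leftConv (ω : C →ₗ[ℂ] ℂ) : C →ₗ[ℂ] C :=
  (TensorProduct.lid ℂ C).toLinearMap ∘ₗ TensorProduct.map ω LinearMap.id ∘ₗ Coalgebra.comul

/-- The convolution operator `x ⋆ = L_{ψ_{S(x)}}`. -/
def convOp (ψ : C →ₗ[ℂ] ℂ) (x : C) : C →ₗ[ℂ] C :=
  leftConv (density ψ (HopfAlgebra.antipode ℂ x))

/-- The Fourier transform of `x`: the functional `ψ_x`, seen in the algebra of functions on
the dual quantum group, which is the dual space of `C` with the convolution product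
`ω * ω' = (ω ⊗ ω') Δ` and the unit `ε`. It carries `⋆` to this product. -/
def fourier (ψ : C →ₗ[ℂ] ℂ) (x : C) : WithConv (C →ₗ[ℂ] ℂ) := WithConv.toConv (density ψ x)

variable (C) in
/-- The coproduct as a unital `*`-homomorphism `C → C ⊗ C`: the action of the quantum group
on itself. -/
def coproductAction [IsCQG C] : C →⋆ₐ[ℂ] C ⊗[ℂ] C :=
  { Bialgebra.comulAlgHom ℂ C with map_star' := IsCQG.comul_star }

end FiniteQuantumGroups

end QuantumCayley

end

noncomputable section

namespace QuantumCayley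

open Coalgebra HopfAlgebra

theorem tensor_ext_of_slices {M N : Type*} [AddCommGroup M] [Module ℂ M] [AddCommGroup N]
    [Module ℂ N] {s t : M ⊗[ℂ] N}
    (h : ∀ ν : M →ₗ[ℂ] ℂ, TensorProduct.lid ℂ N (TensorProduct.map ν LinearMap.id s) =
      TensorProduct.lid ℂ N (TensorProduct.map ν LinearMap.id t)) : s = t := by
  classical
  let b := Module.Basis.ofVectorSpace ℂ M
  apply (TensorProduct.equivFinsuppOfBasisLeft (N := N) b).injective
  ext i
  have key : ∀ r : M ⊗[ℂ] N, TensorProduct.equivFinsuppOfBasisLeft b r i =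
      TensorProduct.lid ℂ N (TensorProduct.map (b.coord i) LinearMap.id r) := by
    intro r
    induction r with
    | zero => simp
    | tmul x y => simp
    | add x y hx hy => simp [hx, hy]
  rw [key, key, h]

section Slices

theorem slice_map_id {M N N' : Type*} [AddCommGroup M] [Module ℂ M] [AddCommGroup N] [Module ℂ N]
    [AddCommGroup N'] [Module ℂ N'] (ν : M →ₗ[ℂ] ℂ) (f : N →ₗ[ℂ] N') (t : M ⊗[ℂ] N) :
    TensorProduct.lid ℂ N'
        (TensorProduct.map ν LinearMap.id (TensorProduct.map LinearMap.id f t)) =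
      f (TensorProduct.lid ℂ N (TensorProduct.map ν LinearMap.id t)) := by
  induction t with
  | zero => simp
  | tmul x y => simp
  | add x y hx hy => simp [hx, hy]

variable {B : Type*} [Ring B] [Algebra ℂ B]

theorem slice_tmul_mul (ψ : B →ₗ[ℂ] ℂ) (a c : B) (t : B ⊗[ℂ] B) :
    TensorProduct.lid ℂ B (TensorProduct.map ψ LinearMap.id ((a ⊗ₜ[ℂ] c) * t)) =
      c * TensorProduct.lid ℂ B
        (TensorProduct.map (ψ ∘ₗ LinearMap.mulLeft ℂ a) LinearMap.id t) := by
  induction t with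
  | zero => simp
  | tmul x y => simp
  | add x y hx hy => simp [mul_add, hx, hy]

theorem slice_mul_tmul (ψ : B →ₗ[ℂ] ℂ) (a c : B) (t : B ⊗[ℂ] B) :
    TensorProduct.lid ℂ B (TensorProduct.map ψ LinearMap.id (t * (a ⊗ₜ[ℂ] c))) =
      TensorProduct.lid ℂ B
        (TensorProduct.map (ψ ∘ₗ LinearMap.mulRight ℂ a) LinearMap.id t) * c := by
  induction t with
  | zero => simp
  | tmul x y => simp
  | add x y hx hy => simp [add_mul, hx, hy]

theorem star_slice_star [StarRing B] [StarModule ℂ B] {H : Type*} [Ring H] [StarRing H]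
    [Algebra ℂ H] [StarModule ℂ H] {ω ω' : B →ₗ[ℂ] ℂ} (h : ∀ y, star (ω (star y)) = ω' y)
    (t : B ⊗[ℂ] H) :
    star (TensorProduct.lid ℂ H (TensorProduct.map ω LinearMap.id (star t))) =
      TensorProduct.lid ℂ H (TensorProduct.map ω' LinearMap.id t) := by
  induction t with
  | zero => simp
  | tmul x y => simp [TensorProduct.star_tmul, ← h]
  | add x y hx hy => simp [hx, hy]

end Slices

section FiniteQuantumSet

variable {B : Type*} [Ring B] [StarRing B] [Algebra ℂ B] [StarModule ℂ B] {ψ : B →ₗ[ℂ] ℂ}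

theorem IsFiniteQuantumSet.map_star (h : IsFiniteQuantumSet ψ) (x : B) :
    ψ (star x) = star (ψ x) := by
  have hr : ∀ y : B, (ψ (star y * y)).im = 0 := fun y => by
    simpa using ((Complex.le_def.1 (h.nonneg y)).2).symm
  have h0 := hr 1
  have hx := hr x
  have h1 := hr (x + 1)
  have h2 := hr (x + Complex.I • 1)
  simp [add_mul, mul_add] at h0 hx h1 h2
  apply Complex.ext <;> simp <;> linarith

theorem IsFiniteQuantumSet.eq_zero_of_mul (h : IsFiniteQuantumSet ψ) {x : B}
    (hx : ∀ b, ψ (x * b) = 0) : x = 0 :=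
  h.faithful x (by rw [h.tracial, hx])

theorem IsMulAdjoint.map_tmul_mul (h : IsFiniteQuantumSet ψ) {d : B →ₗ[ℂ] B ⊗[ℂ] B}
    (hd : IsMulAdjoint ψ d) (a c b : B) :
    LinearMap.mul' ℂ ℂ (TensorProduct.map (ψ ∘ₗ LinearMap.mulLeft ℂ a)
      (ψ ∘ₗ LinearMap.mulLeft ℂ c) (d b)) = ψ (c * a * b) := by
  have key : ∀ t : B ⊗[ℂ] B,
      star (LinearMap.mul' ℂ ℂ (TensorProduct.map ψ ψ (star t * (star a ⊗ₜ[ℂ] star c)))) =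
      LinearMap.mul' ℂ ℂ (TensorProduct.map (ψ ∘ₗ LinearMap.mulLeft ℂ a)
        (ψ ∘ₗ LinearMap.mulLeft ℂ c) t) := by
    intro t
    induction t with
    | zero => simp
    | tmul x y => simp [TensorProduct.star_tmul, ← star_mul, h.map_star]
    | add x y hx hy => simp only [star_add, add_mul, map_add, hx, hy]
  rw [← key, hd, ← h.map_star]
  simp [mul_assoc]

end FiniteQuantumSet

section UnitaryCorep

variable {H : Type*} [Ring H] [StarRing H] [HopfAlgebra ℂ H] {n : ℕ}
  {U : Matrix (Fin n) (Fin n) H}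

theorem IsUnitaryCorep.counit_apply (hU : IsUnitaryCorep U) (i j : Fin n) :
    counit (R := ℂ) (U i j) = (1 : Matrix (Fin n) (Fin n) ℂ) i j := by
  have h : (Matrix.of fun i j => algebraMap ℂ H (counit (U i j))) * U = U := by
    ext i j
    have := congrArg (TensorProduct.lid ℂ H) (rTensor_counit_comul (R := ℂ) (U i j))
    simpa [hU.comul_apply, Matrix.mul_apply, Algebra.smul_def] using this
  have h1 : (Matrix.of fun i j => algebraMap ℂ H (counit (U i j))) = 1 := by
    rw [← hU.mul_conjTranspose, ← h, mul_assoc, h, hU.mul_conjTranspose, mul_one]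
  have h2 := congrArg (counit (R := ℂ)) (congrFun (congrFun h1 i) j)
  rw [Matrix.of_apply, Bialgebra.counit_algebraMap] at h2
  rw [h2, Matrix.one_apply, Matrix.one_apply]
  split_ifs <;> simp

theorem IsUnitaryCorep.antipode_apply (hU : IsUnitaryCorep U) (i j : Fin n) :
    antipode ℂ (U i j) = star (U j i) := by
  have h : U.map (antipode ℂ) * U = 1 := by
    ext i j
    have := mul_antipode_rTensor_comul_apply (R := ℂ) (U i j)
    simp only [hU.comul_apply, hU.counit_apply, map_sum, LinearMap.rTensor_tmul,
      LinearMap.mul'_apply] at this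
    rw [Matrix.mul_apply]
    simp only [Matrix.map_apply, this, Matrix.one_apply]
    split_ifs <;> simp
  have h1 : U.map (antipode ℂ) = U.conjTranspose := by
    rw [← mul_one (U.map _), ← hU.mul_conjTranspose, ← mul_assoc, h, one_mul]
  exact congrFun (congrFun h1 i) j

theorem IsUnitaryCorep.sum_mul_antipode (hU : IsUnitaryCorep U) (i j : Fin n) :
    ∑ k, U i k * antipode ℂ (U k j) = (1 : Matrix (Fin n) (Fin n) H) i j := by
  rw [← hU.mul_conjTranspose, Matrix.mul_apply]
  simp [hU.antipode_apply]

theorem IsUnitaryCorep.sum_antipode_mul (hU : IsUnitaryCorep U) (i j : Fin n) :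
    ∑ k, antipode ℂ (U i k) * U k j = (1 : Matrix (Fin n) (Fin n) H) i j := by
  rw [← hU.conjTranspose_mul, Matrix.mul_apply]
  simp [hU.antipode_apply]

theorem IsUnitaryCorep.comul_antipode [StarModule ℂ H] [IsCQG H] (hU : IsUnitaryCorep U)
    (i j : Fin n) :
    comul (R := ℂ) (antipode ℂ (U i j)) =
      ∑ k, antipode ℂ (U k j) ⊗ₜ[ℂ] antipode ℂ (U i k) := by
  simp [hU.antipode_apply, IsCQG.comul_star, hU.comul_apply, TensorProduct.star_tmul]

/-- Additive predicates on a CQG Hopf `*`-algebra, stable under scalars, can be checked on the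
coefficients of unitary corepresentations. -/
theorem IsCQG.induction [StarModule ℂ H] [IsCQG H] {p : H → Prop}
    (coeff : ∀ (n : ℕ) (U : Matrix (Fin n) (Fin n) H), IsUnitaryCorep U → ∀ i j, p (U i j))
    (zero : p 0) (add : ∀ x y, p x → p y → p (x + y))
    (smul : ∀ (c : ℂ) x, p x → p (c • x)) (x : H) : p x := by
  have hx : x ∈ Submodule.span ℂ {x : H | ∃ (n : ℕ) (u : Matrix (Fin n) (Fin n) H),
      IsUnitaryCorep u ∧ ∃ i j, x = u i j} := by
    rw [IsCQG.span_coeff]; trivial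
  induction hx using Submodule.span_induction with
  | mem x hx =>
    obtain ⟨n, U, hU, i, j, rfl⟩ := hx
    exact coeff n U hU i j
  | zero => exact zero
  | add x y _ _ hx hy => exact add x y hx hy
  | smul c x _ hx => exact smul c x hx

end UnitaryCorep

section Convolution

variable {C : Type*} [Ring C] [HopfAlgebra ℂ C]

theorem leftConv_apply (ω : C →ₗ[ℂ] ℂ) (b : C) :
    leftConv ω b =
      TensorProduct.lid ℂ C (TensorProduct.map ω LinearMap.id (comul (R := ℂ) b)) := rfl

theorem leftConv_one : leftConv (1 : WithConv (C →ₗ[ℂ] ℂ)).ofConv = LinearMap.id := by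
  ext b
  have := congrArg (TensorProduct.lid ℂ C) (rTensor_counit_comul (R := ℂ) b)
  rw [leftConv_apply, LinearMap.id_apply]
  simpa [LinearMap.rTensor, LinearMap.convOne_def] using this

theorem leftConv_mul (μ ν : WithConv (C →ₗ[ℂ] ℂ)) :
    leftConv (μ * ν).ofConv = leftConv ν.ofConv ∘ₗ leftConv μ.ofConv := by
  have key : ∀ t : C ⊗[ℂ] C, leftConv ν.ofConv
      (TensorProduct.lid ℂ C (TensorProduct.map μ.ofConv LinearMap.id t)) =
      TensorProduct.lid ℂ C (TensorProduct.map
        (LinearMap.mul' ℂ ℂ ∘ₗ TensorProduct.map μ.ofConv ν.ofConv) LinearMap.id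
        ((TensorProduct.assoc ℂ C C C).symm (comul.lTensor C t))) := by
    intro t
    induction t with
    | zero => simp
    | add x y hx hy => simp [hx, hy]
    | tmul x y =>
      simp only [TensorProduct.map_tmul, TensorProduct.lid_tmul, LinearMap.id_apply, map_smul,
        leftConv_apply, LinearMap.lTensor_tmul]
      generalize comul (R := ℂ) y = s
      induction s with
      | zero => simp
      | tmul a b => simp [smul_smul]
      | add a b ha hb => simp [TensorProduct.tmul_add, ha, hb]
  ext b
  rw [LinearMap.comp_apply, leftConv_apply, leftConv_apply μ.ofConv, key, coassoc_symm_apply]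
  generalize comul (R := ℂ) b = s
  induction s with
  | zero => simp
  | tmul x y => simp [LinearMap.convMul_def]
  | add x y hx hy => simp [hx, hy]

theorem counit_leftConv (ω : C →ₗ[ℂ] ℂ) : counit (R := ℂ) ∘ₗ leftConv ω = ω := by
  ext b
  have h : ∀ t : C ⊗[ℂ] C,
      counit (R := ℂ) (TensorProduct.lid ℂ C (TensorProduct.map ω LinearMap.id t)) =
      ω (TensorProduct.rid ℂ C (counit.lTensor C t)) := by
    intro t
    induction t with
    | zero => simp
    | tmul x y => simp [mul_comm]
    | add x y hx hy => simp [hx, hy]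
  rw [LinearMap.comp_apply, leftConv_apply, h, lTensor_counit_comul]
  simp

theorem leftConv_add (ω ω' : C →ₗ[ℂ] ℂ) : leftConv (ω + ω') = leftConv ω + leftConv ω' := by
  ext; simp [leftConv_apply, TensorProduct.map_add_left]

theorem leftConv_smul (c : ℂ) (ω : C →ₗ[ℂ] ℂ) : leftConv (c • ω) = c • leftConv ω := by
  ext; simp [leftConv_apply, TensorProduct.map_smul_left]

end Convolution

section Haar

variable {C : Type*} [Ring C] [StarRing C] [HopfAlgebra ℂ C] [StarModule ℂ C]
  {ψ : C →ₗ[ℂ] ℂ}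

theorem IsUnitaryCorep.haar_antipode_mul [IsCQG C] (hψ : IsHaarOneForm ψ) {n : ℕ}
    {U : Matrix (Fin n) (Fin n) C} (hU : IsUnitaryCorep U) (k j : Fin n) (b : C) :
    ∑ l, antipode ℂ (U k l) * convOp ψ (U l j) b =
      ψ (antipode ℂ (U k j) * b) • (1 : C) := by
  rw [← hψ.left, Bialgebra.comul_mul, hU.comul_antipode, Finset.sum_mul, map_sum, map_sum]
  exact Finset.sum_congr rfl fun l _ => (slice_tmul_mul _ _ _ _).symm

theorem IsUnitaryCorep.haar_mul_antipode [IsCQG C] (hψ : IsHaarOneForm ψ) {n : ℕ}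
    {U : Matrix (Fin n) (Fin n) C} (hU : IsUnitaryCorep U) (k j : Fin n) (b : C) :
    ∑ l, convOp ψ (U l j) b * antipode ℂ (U k l) =
      ψ (antipode ℂ (U k j) * b) • (1 : C) := by
  rw [hψ.tracial, ← hψ.left, Bialgebra.comul_mul, hU.comul_antipode, Finset.mul_sum, map_sum,
    map_sum]
  refine Finset.sum_congr rfl fun l _ => ?_
  rw [slice_mul_tmul]
  have : ψ ∘ₗ LinearMap.mulRight ℂ (antipode ℂ (U l j)) = density ψ (antipode ℂ (U l j)) := by
    ext y
    exact hψ.tracial _ _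
  rw [this]
  rfl

theorem IsUnitaryCorep.convOp_apply [IsCQG C] (hψ : IsHaarOneForm ψ) {n : ℕ}
    {U : Matrix (Fin n) (Fin n) C} (hU : IsUnitaryCorep U) (i j : Fin n) (b : C) :
    convOp ψ (U i j) b = ∑ k, ψ (antipode ℂ (U k j) * b) • U i k := by
  have h : ∀ k, ψ (antipode ℂ (U k j) * b) • U i k =
      ∑ l, U i k * antipode ℂ (U k l) * convOp ψ (U l j) b := fun k => by
    simp_rw [mul_assoc, ← Finset.mul_sum, hU.haar_antipode_mul hψ, mul_smul_comm, mul_one]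
  simp_rw [h]
  rw [Finset.sum_comm]
  simp_rw [← Finset.sum_mul, hU.sum_mul_antipode, Matrix.one_apply]
  simp

theorem antipode_antipode_of_haar [IsCQG C] (hψ : IsHaarOneForm ψ) (x : C) :
    antipode ℂ (antipode ℂ x) = x := by
  induction x using IsCQG.induction with
  | zero => simp
  | add x y hx hy => simp [hx, hy]
  | smul c x hx => simp [hx]
  | coeff n U hU i j =>
    have h1 : ∀ b, convOp ψ (U i j) b =
        ∑ k, ψ (antipode ℂ (U k j) * b) • antipode ℂ (antipode ℂ (U i k)) := by
      intro b
      have h : ∀ k, ψ (antipode ℂ (U k j) * b) • antipode ℂ (antipode ℂ (U i k)) =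
          ∑ l, convOp ψ (U l j) b * antipode ℂ (antipode ℂ (U i k) * U k l) := fun k => by
        simp_rw [antipode_mul_antidistrib, ← mul_assoc, ← Finset.sum_mul,
          hU.haar_mul_antipode hψ, smul_mul_assoc, one_mul]
      simp_rw [h]
      rw [Finset.sum_comm]
      simp_rw [← Finset.mul_sum, ← map_sum, hU.sum_antipode_mul, Matrix.one_apply, apply_ite]
      simp
    rw [← sub_eq_zero, ← Module.forall_dual_apply_eq_zero_iff ℂ]
    intro φ
    have h2 : ∑ k, φ (antipode ℂ (antipode ℂ (U i k)) - U i k) • antipode ℂ (U k j) = 0 := by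
      refine hψ.eq_zero_of_mul fun b => ?_
      have h3 := congrArg φ ((h1 b).symm.trans (hU.convOp_apply hψ i j b))
      simp only [map_sum, map_smul, smul_eq_mul] at h3
      simp only [Finset.sum_mul, map_sum, smul_mul_assoc, map_smul, map_sub, smul_eq_mul,
        sub_mul, Finset.sum_sub_distrib]
      simp_rw [mul_comm (φ _)]
      rw [h3, sub_self]
    simpa [hU.counit_apply, Matrix.one_apply] using congrArg (counit (R := ℂ)) h2

theorem star_antipode_of_haar [IsCQG C] (hψ : IsHaarOneForm ψ) (x : C) :
    star (antipode ℂ x) = antipode ℂ (star x) := by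
  induction x using IsCQG.induction with
  | zero => simp
  | add x y hx hy => simp [hx, hy]
  | smul c x hx => simp [hx]
  | coeff n U hU i j =>
    rw [← hU.antipode_apply, antipode_antipode_of_haar hψ, hU.antipode_apply, star_star]

theorem conv_comp_antipode [IsCQG C] (μ ν : WithConv (C →ₗ[ℂ] ℂ)) :
    WithConv.toConv ((μ * ν).ofConv ∘ₗ antipode ℂ) =
      WithConv.toConv (ν.ofConv ∘ₗ antipode ℂ) * WithConv.toConv (μ.ofConv ∘ₗ antipode ℂ) := by
  ext x
  induction x using IsCQG.induction with
  | zero => simp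
  | add x y hx hy => simp_all
  | smul c x hx => simp_all
  | coeff n U hU i j =>
    simp [LinearMap.convMul_def, hU.comul_antipode, hU.comul_apply, mul_comm]

theorem haar_antipode [IsCQG C] (hψ : IsHaarOneForm ψ) (x : C) :
    ψ (antipode ℂ x) = ψ x := by
  have h1 : ψ 1 * ψ (antipode ℂ x) = ψ 1 * ψ x := by
    induction x using IsCQG.induction with
    | zero => simp
    | add x y hx hy => simp only [map_add, mul_add, hx, hy]
    | smul c x hx => simp only [map_smul, smul_eq_mul, mul_left_comm _ c, hx]
    | coeff n U hU i j =>
      have h := congrArg (ψ ∘ₗ antipode ℂ) (hψ.left (antipode ℂ (U i j)))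
      have h' := congrArg (ψ ∘ₗ antipode ℂ) (hψ.left (U i j))
      simp only [hU.comul_antipode, hU.comul_apply, map_sum, TensorProduct.map_tmul,
        LinearMap.comp_apply, TensorProduct.lid_tmul, LinearMap.id_apply, map_smul,
        antipode_antipode_of_haar hψ, antipode_one, smul_eq_mul] at h h'
      rw [mul_comm, ← h, mul_comm, ← h']
      exact Finset.sum_congr rfl fun k _ => mul_comm _ _
  refine mul_left_cancel₀ (fun h0 => ?_) h1
  have h1 : (1 : C) = 0 := hψ.faithful 1 (by simpa using h0)
  simpa using congrArg (counit (R := ℂ)) h1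

theorem density_antipode [IsCQG C] (hψ : IsHaarOneForm ψ) (x : C) :
    density ψ (antipode ℂ x) = density ψ x ∘ₗ antipode ℂ := by
  ext y
  simp only [density, LinearMap.comp_apply, LinearMap.mulLeft_apply]
  rw [← haar_antipode hψ, antipode_mul_antidistrib, antipode_antipode_of_haar hψ, hψ.tracial]

theorem convOp_apply_eq_rid [IsCQG C] (hψ : IsHaarOneForm ψ) (x b : C) :
    convOp ψ x b = TensorProduct.rid ℂ C (TensorProduct.map LinearMap.id
      (ψ ∘ₗ LinearMap.mulRight ℂ b ∘ₗ antipode ℂ) (comul (R := ℂ) x)) := by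
  induction x using IsCQG.induction with
  | zero => simp [convOp, density, leftConv_apply]
  | add x y hx hy =>
    have h : density ψ (antipode ℂ (x + y)) =
        density ψ (antipode ℂ x) + density ψ (antipode ℂ y) := by
      ext; simp [density, add_mul]
    rw [map_add, map_add, map_add, ← hx, ← hy, convOp, h, leftConv_add, LinearMap.add_apply]
    rfl
  | smul c x hx =>
    have h : density ψ (antipode ℂ (c • x)) = c • density ψ (antipode ℂ x) := by
      ext; simp [density]
    rw [map_smul, map_smul, map_smul, ← hx, convOp, h, leftConv_smul, LinearMap.smul_apply]
    rfl
  | coeff n U hU i j => simp [hU.convOp_apply hψ, hU.comul_apply]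

theorem schur_convOp [IsCQG C] (hψ : IsHaarOneForm ψ) {d : C →ₗ[ℂ] C ⊗[ℂ] C}
    (hd : IsMulAdjoint ψ d) (x y : C) :
    LinearMap.mul' ℂ C ∘ₗ TensorProduct.map (convOp ψ x) (convOp ψ y) ∘ₗ d =
      convOp ψ (x * y) := by
  ext b
  have hconv : ∀ z, convOp ψ z = ∑ i ∈ (ℛ ℂ z).index,
      (LinearMap.toSpanSingleton ℂ C ((ℛ ℂ z).left i)) ∘ₗ
        (ψ ∘ₗ LinearMap.mulLeft ℂ (antipode ℂ ((ℛ ℂ z).right i))) := by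
    intro z
    ext b
    rw [convOp_apply_eq_rid hψ, ← (ℛ ℂ z).eq]
    simp
  have hmul : ∀ (a a' : C) (φ φ' : C →ₗ[ℂ] ℂ) (t : C ⊗[ℂ] C),
      LinearMap.mul' ℂ C (TensorProduct.map (LinearMap.toSpanSingleton ℂ C a ∘ₗ φ)
        (LinearMap.toSpanSingleton ℂ C a' ∘ₗ φ') t) =
      LinearMap.mul' ℂ ℂ (TensorProduct.map φ φ' t) • (a * a') := by
    intro a a' φ φ' t
    induction t with
    | zero => simp
    | tmul x y => simp [smul_smul, mul_comm]
    | add x y hx hy => simp [hx, hy, add_smul]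
  rw [convOp_apply_eq_rid hψ, Bialgebra.comul_mul, ← (ℛ ℂ x).eq, ← (ℛ ℂ y).eq, hconv x, hconv y,
    Finset.sum_mul_sum, Finset.sum_comm]
  simp only [LinearMap.comp_apply, ← TensorProduct.mapBilinear_apply, LinearMap.sum_apply, map_sum]
  simp only [TensorProduct.mapBilinear_apply, hmul, IsMulAdjoint.map_tmul_mul hψ.toIsFiniteQuantumSet hd,
    Algebra.TensorProduct.tmul_mul_tmul, TensorProduct.map_tmul,
    TensorProduct.rid_tmul, antipode_mul_antidistrib, LinearMap.id_apply, LinearMap.comp_apply,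
    LinearMap.mulRight_apply]

theorem isQuantumGraph_convOp [IsCQG C] (hψ : IsHaarOneForm ψ) {P : C}
    (hP : IsStarProjection P) : IsQuantumGraph ψ (convOp ψ P) where
  schur_idempotent := by
    obtain ⟨d, hd, -⟩ := hψ.one_form
    exact ⟨d, hd, by rw [schur_convOp hψ hd, hP.isIdempotentElem.eq]⟩
  real f := by
    rw [convOp, leftConv_apply, leftConv_apply, IsCQG.comul_star]
    refine star_slice_star (fun y => ?_) _
    simp only [density, LinearMap.comp_apply, LinearMap.mulLeft_apply]
    rw [← hψ.map_star, star_mul, star_star, star_antipode_of_haar hψ,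
      hP.isSelfAdjoint.star_eq, hψ.tracial]

end Haar

section Actions

variable {C : Type*} [Ring C] [StarRing C] [HopfAlgebra ℂ C] [StarModule ℂ C]

/-- The functionals `μ` such that convolution by `μ ∘ S` commutes with a linear map
`β : C → C ⊗ H` form a subalgebra of the dual of `C`. -/
def commutingFunctionals [IsCQG C] {H : Type*} [AddCommGroup H] [Module ℂ H]
    (β : C →ₗ[ℂ] C ⊗[ℂ] H) : Subalgebra ℂ (WithConv (C →ₗ[ℂ] ℂ)) where
  carrier := {μ | TensorProduct.map (leftConv (μ.ofConv ∘ₗ antipode ℂ)) LinearMap.id ∘ₗ β =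
    β ∘ₗ leftConv (μ.ofConv ∘ₗ antipode ℂ)}
  mul_mem' {μ ν} hμ hν := by
    have h := leftConv_mul (WithConv.toConv (ν.ofConv ∘ₗ antipode ℂ))
      (WithConv.toConv (μ.ofConv ∘ₗ antipode ℂ))
    rw [← conv_comp_antipode] at h
    simp only at h
    simp only [Set.mem_ofPred_eq] at hμ hν ⊢
    rw [h, ← LinearMap.comp_assoc, ← hμ, LinearMap.comp_assoc, ← hν, ← LinearMap.comp_assoc,
      ← TensorProduct.map_comp, LinearMap.id_comp]
  add_mem' {μ ν} hμ hν := by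
    simp only [Set.mem_ofPred_eq] at hμ hν ⊢
    rw [WithConv.ofConv_add, LinearMap.add_comp, leftConv_add, TensorProduct.map_add_left,
      LinearMap.add_comp, hμ, hν, LinearMap.comp_add]
  algebraMap_mem' c := by
    have h : (algebraMap ℂ (WithConv (C →ₗ[ℂ] ℂ)) c).ofConv ∘ₗ antipode ℂ =
        c • (1 : WithConv (C →ₗ[ℂ] ℂ)).ofConv := by
      rw [Algebra.algebraMap_eq_smul_one, WithConv.ofConv_smul, LinearMap.smul_comp]
      congr 1
      ext x
      simp [LinearMap.convOne_def]
    simp only [Set.mem_ofPred_eq]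
    rw [h, leftConv_smul, leftConv_one, TensorProduct.map_smul_left, TensorProduct.map_id,
      LinearMap.smul_comp, LinearMap.comp_smul, LinearMap.id_comp, LinearMap.comp_id]

theorem leftConv_commutes [IsCQG C] {ψ : C →ₗ[ℂ] ℂ} (hψ : IsHaarOneForm ψ) {P : C}
    (hgen : Algebra.adjoin ℂ {fourier ψ P} = ⊤)
    {H : Type*} [AddCommGroup H] [Module ℂ H] {β : C →ₗ[ℂ] C ⊗[ℂ] H}
    (hβ : ∀ b, TensorProduct.map (convOp ψ P) LinearMap.id (β b) = β (convOp ψ P b))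
    (ν : C →ₗ[ℂ] ℂ) (b : C) :
    TensorProduct.map (leftConv ν) LinearMap.id (β b) = β (leftConv ν b) := by
  have htop : commutingFunctionals β = ⊤ := by
    rw [eq_top_iff, ← hgen, Algebra.adjoin_le_iff, Set.singleton_subset_iff]
    have h : leftConv ((fourier ψ P).ofConv ∘ₗ antipode ℂ) = convOp ψ P := by
      rw [convOp, density_antipode hψ]
      rfl
    change TensorProduct.map _ _ ∘ₗ _ = _
    rw [h]
    exact LinearMap.ext hβ
  have hν : WithConv.toConv (ν ∘ₗ antipode ℂ) ∈ commutingFunctionals β := htop ▸ trivial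
  have hS : (ν ∘ₗ antipode ℂ) ∘ₗ antipode ℂ = ν := by
    ext x
    simp [antipode_antipode_of_haar hψ]
  change TensorProduct.map (leftConv ((ν ∘ₗ antipode ℂ) ∘ₗ antipode ℂ)) _ ∘ₗ _ = _ at hν
  rw [WithConv.ofConv_toConv, hS] at hν
  exact LinearMap.congr_fun hν b

end Actions

section Universality

variable {C : Type*} [Ring C] [StarRing C] [HopfAlgebra ℂ C] [StarModule ℂ C]

theorem isGraphAction_coproductAction [IsCQG C] {ψ : C →ₗ[ℂ] ℂ} (hψ : IsHaarOneForm ψ) (P : C) :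
    IsGraphAction ψ (convOp ψ P) (coproductAction C) where
  injective := by
    refine Function.LeftInverse.injective
      (g := fun t => TensorProduct.lid ℂ C (counit.rTensor C t)) fun x => ?_
    change TensorProduct.lid ℂ C (counit.rTensor C (comul x)) = x
    simp
  action_eq b := coassoc_apply b
  preserves_functional b := hψ.left b
  preserves_adjacency b := by
    have h : ∀ t : C ⊗[ℂ] C, TensorProduct.map (convOp ψ P) LinearMap.id t =
        TensorProduct.lid ℂ (C ⊗[ℂ] C) (TensorProduct.map (density ψ (antipode ℂ P))
          LinearMap.id (TensorProduct.assoc ℂ C C C (comul.rTensor C t))) := by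
      intro t
      induction t with
      | zero => simp
      | add x y hx hy => simp [hx, hy]
      | tmul x y =>
        simp only [TensorProduct.map_tmul, convOp, leftConv_apply, LinearMap.rTensor_tmul,
          LinearMap.id_apply]
        generalize comul (R := ℂ) x = s
        induction s with
        | zero => simp
        | tmul a b => simp [TensorProduct.smul_tmul']
        | add a b ha hb => simp [TensorProduct.add_tmul, ha, hb]
    have h' : ∀ t : C ⊗[ℂ] C, comul (R := ℂ) (TensorProduct.lid ℂ C
        (TensorProduct.map (density ψ (antipode ℂ P)) LinearMap.id t)) =
        TensorProduct.lid ℂ (C ⊗[ℂ] C) (TensorProduct.map (density ψ (antipode ℂ P))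
          LinearMap.id (comul.lTensor C t)) := by
      intro t
      induction t with
      | zero => simp
      | tmul x y => simp
      | add x y hx hy => simp [hx, hy]
    change TensorProduct.map _ _ (comul b) = comul (convOp ψ P b)
    rw [h, coassoc_apply, convOp, leftConv_apply, h']

theorem isFaithfulAction_coproductAction [IsCQG C] : IsFaithfulAction (coproductAction C) := by
  intro D hD _ _
  refine eq_top_iff.2 fun x _ => ?_
  have h := hD (counit (R := ℂ)) x
  have hx : TensorProduct.lid ℂ C (counit.rTensor C (comul (R := ℂ) x)) = x := by simp
  exact hx ▸ h

variable {H : Type*} [Ring H] [StarRing H] [HopfAlgebra ℂ H] [StarModule ℂ H]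

/-- The slice `(ε ⊗ id) β` of an action of `ℍ` on the underlying algebra of `C`. -/
def counitSlice (β : C →⋆ₐ[ℂ] C ⊗[ℂ] H) : C →ₐ[ℂ] H :=
  (Algebra.TensorProduct.lid ℂ H).toAlgHom.comp
    ((Algebra.TensorProduct.map (Bialgebra.counitAlgHom ℂ C) (AlgHom.id ℂ H)).comp β.toAlgHom)

theorem counitSlice_apply (β : C →⋆ₐ[ℂ] C ⊗[ℂ] H) (b : C) :
    counitSlice β b =
      TensorProduct.lid ℂ H (TensorProduct.map counit LinearMap.id (β b)) := rfl

theorem map_counitSlice_comul {β : C →⋆ₐ[ℂ] C ⊗[ℂ] H}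
    (h : ∀ (ν : C →ₗ[ℂ] ℂ) (b : C),
      TensorProduct.map (leftConv ν) LinearMap.id (β b) = β (leftConv ν b)) (b : C) :
    TensorProduct.map LinearMap.id (counitSlice β).toLinearMap (comul (R := ℂ) b) = β b := by
  refine tensor_ext_of_slices fun ν => ?_
  rw [slice_map_id, ← leftConv_apply, AlgHom.toLinearMap_apply, counitSlice_apply, ← h,
    ← LinearMap.comp_apply (TensorProduct.map _ _), ← TensorProduct.map_comp, counit_leftConv,
    LinearMap.id_comp]

theorem IsAction.rid_counit {B : Type*} [Ring B] [StarRing B] [Algebra ℂ B]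
    [StarModule ℂ B] {β : B →⋆ₐ[ℂ] B ⊗[ℂ] H} (hβ : IsAction β) (b : B) :
    TensorProduct.rid ℂ B (TensorProduct.map LinearMap.id counit (β b)) = b := by
  apply hβ.injective
  have h1 : ∀ t : B ⊗[ℂ] H,
      β (TensorProduct.rid ℂ B (TensorProduct.map LinearMap.id counit t)) =
      TensorProduct.rid ℂ (B ⊗[ℂ] H) (TensorProduct.map LinearMap.id counit
        (TensorProduct.map β.toAlgHom.toLinearMap LinearMap.id t)) := by
    intro t
    induction t with
    | zero => simp
    | tmul x y => simp
    | add x y hx hy => simp only [map_add, hx, hy]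
  have h2 : ∀ t : B ⊗[ℂ] H, TensorProduct.rid ℂ (B ⊗[ℂ] H) (TensorProduct.map LinearMap.id counit
      ((TensorProduct.assoc ℂ B H H).symm
        (TensorProduct.map LinearMap.id (comul (R := ℂ) (A := H)) t))) = t := by
    intro t
    induction t with
    | zero => simp
    | add x y hx hy => simp only [map_add, hx, hy]
    | tmul x y =>
      have h3 : ∀ s : H ⊗[ℂ] H, TensorProduct.rid ℂ (B ⊗[ℂ] H)
          (TensorProduct.map LinearMap.id counit
            ((TensorProduct.assoc ℂ B H H).symm (x ⊗ₜ[ℂ] s))) =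
          x ⊗ₜ[ℂ] TensorProduct.rid ℂ H (counit.lTensor H s) := by
        intro s
        induction s with
        | zero => simp
        | tmul a b => simp
        | add a b ha hb => simp only [map_add, TensorProduct.tmul_add, ha, hb]
      rw [TensorProduct.map_tmul, LinearMap.id_apply, h3, lTensor_counit_comul]
      simp
  have h3 := h2 (β b)
  rwa [← hβ.action_eq, LinearEquiv.symm_apply_apply, ← h1] at h3

theorem counit_counitSlice {β : C →⋆ₐ[ℂ] C ⊗[ℂ] H} (hβ : IsAction β) (b : C) :
    counit (R := ℂ) (counitSlice β b) = counit (R := ℂ) b := by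
  have h : ∀ t : C ⊗[ℂ] H, counit (R := ℂ)
      (TensorProduct.lid ℂ H (TensorProduct.map (counit (R := ℂ) (A := C)) LinearMap.id t)) =
      counit (R := ℂ) (TensorProduct.rid ℂ C (TensorProduct.map LinearMap.id counit t)) := by
    intro t
    induction t with
    | zero => simp
    | tmul x y => simp [mul_comm]
    | add x y hx hy => simp only [map_add, hx, hy]
  rw [counitSlice_apply, h, hβ.rid_counit]

theorem comul_counitSlice {β : C →⋆ₐ[ℂ] C ⊗[ℂ] H} (hβ : IsAction β)
    (h : ∀ b, TensorProduct.map LinearMap.id (counitSlice β).toLinearMap (comul (R := ℂ) b) = β b)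
    (b : C) :
    TensorProduct.map (counitSlice β).toLinearMap (counitSlice β).toLinearMap
      (comul (R := ℂ) b) = comul (R := ℂ) (counitSlice β b) := by
  have h1 : ∀ t : C ⊗[ℂ] H, comul (R := ℂ)
      (TensorProduct.lid ℂ H (TensorProduct.map (counit (R := ℂ) (A := C)) LinearMap.id t)) =
      TensorProduct.lid ℂ (H ⊗[ℂ] H) (TensorProduct.map (counit (R := ℂ) (A := C)) LinearMap.id
        (TensorProduct.map LinearMap.id (comul (R := ℂ) (A := H)) t)) := by
    intro t
    induction t with
    | zero => simp
    | tmul x y => simp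
    | add x y hx hy => simp only [map_add, hx, hy]
  have h2 : ∀ t : C ⊗[ℂ] H, TensorProduct.lid ℂ (H ⊗[ℂ] H)
      (TensorProduct.map (counit (R := ℂ) (A := C)) LinearMap.id (TensorProduct.assoc ℂ C H H
        (TensorProduct.map β.toAlgHom.toLinearMap LinearMap.id t))) =
      TensorProduct.map (counitSlice β).toLinearMap LinearMap.id t := by
    intro t
    induction t with
    | zero => simp
    | add x y hx hy => simp only [map_add, hx, hy]
    | tmul x y =>
      rw [TensorProduct.map_tmul, TensorProduct.map_tmul, AlgHom.toLinearMap_apply,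
        AlgHom.toLinearMap_apply, counitSlice_apply]
      change TensorProduct.lid ℂ (H ⊗[ℂ] H) (TensorProduct.map _ _
        (TensorProduct.assoc ℂ C H H (β x ⊗ₜ[ℂ] y))) = _
      generalize β x = s
      induction s with
      | zero => simp
      | tmul a b => simp [TensorProduct.smul_tmul']
      | add a b ha hb => simp only [map_add, TensorProduct.add_tmul, ha, hb]
  rw [counitSlice_apply, h1, ← hβ.action_eq, h2, ← h,
    ← LinearMap.comp_apply (TensorProduct.map _ _) (TensorProduct.map _ _),
    ← TensorProduct.map_comp, LinearMap.id_comp, LinearMap.comp_id]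

theorem counitSlice_star [IsCQG C] (β : C →⋆ₐ[ℂ] C ⊗[ℂ] H) (b : C) :
    counitSlice β (star b) = star (counitSlice β b) := by
  rw [counitSlice_apply, counitSlice_apply, map_star, ← star_star (TensorProduct.lid ℂ H _)]
  congr 1
  exact star_slice_star (fun y => by rw [IsCQG.counit_star, star_star]) _

/-- A linear factorisation of `β` through the coproduct is determined by `β`. -/
theorem eq_counitSlice {β : C →⋆ₐ[ℂ] C ⊗[ℂ] H} {f : C →ₗ[ℂ] H}
    (hf : ∀ b, TensorProduct.map LinearMap.id f (comul (R := ℂ) b) = β b) (b : C) :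
    f b = counitSlice β b := by
  rw [counitSlice_apply, ← hf, slice_map_id]
  exact congrArg f (LinearMap.congr_fun leftConv_one b).symm

theorem existsUnique_of_isGraphAction [IsCQG C] {ψ : C →ₗ[ℂ] ℂ} (hψ : IsHaarOneForm ψ) {P : C}
    (hgen : Algebra.adjoin ℂ {fourier ψ P} = ⊤) {β : C →⋆ₐ[ℂ] C ⊗[ℂ] H}
    (hβ : IsGraphAction ψ (convOp ψ P) β) :
    ∃! γ : C →ₐc[ℂ] H, (∀ x, γ (star x) = star (γ x)) ∧
      ∀ b : C, TensorProduct.map LinearMap.id (γ : C →ₗ[ℂ] H) (coproductAction C b) = β b := by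
  have hfac := map_counitSlice_comul
    (leftConv_commutes hψ hgen (β := β.toAlgHom.toLinearMap) hβ.preserves_adjacency)
  refine ⟨BialgHom.ofAlgHom (counitSlice β)
    (AlgHom.ext fun b => counit_counitSlice hβ.toIsAction b)
    (AlgHom.ext fun b => comul_counitSlice hβ.toIsAction hfac b),
    ⟨counitSlice_star β, hfac⟩, fun γ hγ => ?_⟩
  exact BialgHom.ext fun b => eq_counitSlice (f := (γ : C →ₗ[ℂ] H)) hγ.2 b

theorem isQut_coproductAction (C : Type u) [Ring C] [StarRing C] [HopfAlgebra ℂ C]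
    [StarModule ℂ C] [IsCQG C] {ψ : C →ₗ[ℂ] ℂ} (hψ : IsHaarOneForm ψ) {P : C}
    (hgen : Algebra.adjoin ℂ {fourier ψ P} = ⊤) :
    IsQut.{u, u, v} ψ (convOp ψ P) C (coproductAction C) where
  isCQG := inferInstance
  isGraphAction := isGraphAction_coproductAction hψ P
  isFaithful := isFaithfulAction_coproductAction
  universal _ _ _ _ _ _ _ hβ := existsUnique_of_isGraphAction hψ hgen hβ

/-- A graph quantum automorphism group is unique up to a unique isomorphism. -/
theorem IsQut.exists_bialgEquiv {B : Type v} [Ring B] [StarRing B] [Algebra ℂ B] [StarModule ℂ B]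
    {ψ : B →ₗ[ℂ] ℂ} {A : B →ₗ[ℂ] B}
    {Q R : Type u} [Ring Q] [StarRing Q] [HopfAlgebra ℂ Q] [StarModule ℂ Q]
    [Ring R] [StarRing R] [HopfAlgebra ℂ R] [StarModule ℂ R]
    {α : B →⋆ₐ[ℂ] B ⊗[ℂ] Q} {β : B →⋆ₐ[ℂ] B ⊗[ℂ] R}
    (hα : IsQut.{v, u, u} ψ A Q α) (hβ : IsQut.{v, u, u} ψ A R β) :
    ∃ q : Q ≃ₐc[ℂ] R, (∀ x, q (star x) = star (q x)) ∧
      ∀ b : B, TensorProduct.map LinearMap.id (q : Q →ₗ[ℂ] R) (α b) = β b := by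
  have := hα.isCQG
  have := hβ.isCQG
  obtain ⟨f, ⟨hfs, hf⟩, -⟩ := hα.universal R β hβ.isGraphAction
  obtain ⟨g, ⟨hgs, hg⟩, -⟩ := hβ.universal Q α hα.isGraphAction
  have hgf : g.comp f = BialgHom.id ℂ Q := by
    refine (hα.universal Q α hα.isGraphAction).unique ⟨fun x => ?_, fun b => ?_⟩
      ⟨fun x => rfl, fun b => ?_⟩
    · simp [hfs, hgs]
    · refine Eq.trans ?_ (hg b)
      rw [← hf, ← LinearMap.comp_apply, ← TensorProduct.map_comp]
      rfl
    · exact LinearMap.congr_fun (TensorProduct.map_id) (α b)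
  have hfg : f.comp g = BialgHom.id ℂ R := by
    refine (hβ.universal R β hβ.isGraphAction).unique ⟨fun x => ?_, fun b => ?_⟩
      ⟨fun x => rfl, fun b => ?_⟩
    · simp [hfs, hgs]
    · refine Eq.trans ?_ (hf b)
      rw [← hg, ← LinearMap.comp_apply, ← TensorProduct.map_comp]
      rfl
    · exact LinearMap.congr_fun (TensorProduct.map_id) (β b)
  exact ⟨BialgEquiv.ofBialgHom f g hfg hgf, hfs, hf⟩

end Universality

end QuantumCayley

end

theorem proposition4p5
    (C : Type u) [Ring C] [StarRing C] [HopfAlgebra ℂ C] [StarModule ℂ C]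
    [QuantumCayley.IsCQG C] [FiniteDimensional ℂ C]
    (ψ : C →ₗ[ℂ] ℂ) (hψ : QuantumCayley.IsHaarOneForm ψ)
    (P : C) (hP : IsStarProjection P)
    (hgen : Algebra.adjoin ℂ {QuantumCayley.fourier ψ P} = ⊤) :
    QuantumCayley.IsQuantumGraph ψ (QuantumCayley.convOp ψ P) ∧
    QuantumCayley.IsQut.{u, u, v} ψ (QuantumCayley.convOp ψ P) C
      (QuantumCayley.coproductAction C) ∧
    ∀ (Q : Type u) [Ring Q] [StarRing Q] [HopfAlgebra ℂ Q] [StarModule ℂ Q]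
      (α : C →⋆ₐ[ℂ] C ⊗[ℂ] Q),
      QuantumCayley.IsQut.{u, u, u} ψ (QuantumCayley.convOp ψ P) Q α →
      ∃ q : Q ≃ₐc[ℂ] C, (∀ x, q (star x) = star (q x)) ∧
        ∀ b : C, TensorProduct.map LinearMap.id (q : Q →ₗ[ℂ] C) (α b) =
          QuantumCayley.coproductAction C b :=
  ⟨QuantumCayley.isQuantumGraph_convOp hψ hP, QuantumCayley.isQut_coproductAction C hψ hgen,
    fun _ _ _ _ _ _ hα => hα.exists_bialgEquiv (QuantumCayley.isQut_coproductAction C hψ hgen)⟩
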